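/- Let $(M,g)$ be a finite-dimensional smooth Riemannian manifold (without boundary) that is connected and complete, with geodesic distance $d$, and assume that any two points $x,y\in M$ uniquely determine a geodesic $\gamma$ with $\gamma(0)=x$, $\gamma(1)=y$. Here geodesics are the smooth curves with parallel velocity for the Levi-Civita connection, $\exp_x(u)=\gamma(1)$ for the geodesic with $\gamma(0)=x$, $\gamma'(0)=u$, and $\Gamma_y^x:T_yM\to T_xM$ denotes parallel transport along the geodesic from $y$ to $x$. Let $f:M\to\mathbb R$ be differentiable with Riemannian gradient $\operatorname{grad} f$, and let $0<\mu\le L$. Assume that * $f$ is $\mu$-gradient dominated: $f$ attains its minimum $f^*=\min_M f$, and $2\mu\,[f(x)-f^*]\le\langle\operatorname{grad} f(x),\operatorname{grad} f(x)\rangle_x$ for all $x\in M$; * $f$ has $L$-Lipschitz gradient: for all $x,y\in M$, $\langle \operatorname{grad} f(x)-\Gamma_y^x\operatorname{grad} f(y),\ \operatorname{grad} f(x)-\Gamma_y^x\operatorname{grad} f(y)\rangle_x\le L^2 d(x,y)^2$. Let $0<\alpha\le 1/(4L)$, let $x_0\in M$ be deterministic, and let the random iterates satisfy, for $t\ge 0$,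 $$x_{t+1}=\exp_{x_t}\bigl(-\alpha\,(\operatorname{grad} f(x_t)+\delta_t)\bigr),\qquad \delta_t\in T_{x_t}M .$$ Let $\mathcal F_t=\sigma(x_0,\dots,x_t)$ and suppose that there are real numbers $\varepsilon_t$ such that $\langle\delta_t,\delta_t\rangle_{x_t}$ is integrable and $\mathbb E[\langle\delta_t,\delta_t\rangle_{x_t}\mid\mathcal F_t]=\varepsilon_t$ almost surely for all $t\ge0$. Put $\rho=1-\alpha\mu/2$. Then for every $t\ge 0$ the random variable $f(x_t)$ is integrable and $$\mathbb E[f(x_t)]-f^*\le\rho^t\,[f(x_0)-f^*]+\alpha\,\rho^t\sum_{\ell=0}^{t-1}\varepsilon_\ell\,\rho^{-(\ell+1)} .$$ Moreover, if $\varepsilon_t\to0$ as $t\to\infty$, then $\mathbb E[f(x_t)]-f^*\to0$. -/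

import Mathlib

open scoped Manifold ContDiff Topology Bundle
open MeasureTheory Bundle

namespace RiemannianSGD

noncomputable section

section Geometry

variable {E : Type*} [NormedAddCommGroup E] [NormedSpace ℝ E]
  {M : Type*} [MetricSpace M] [ChartedSpace E M]

/-- The velocity `γ'(t) ∈ T_{γ(t)} M` of a curve `γ : ℝ → M`. -/
def velocity (γ : ℝ → M) (t : ℝ) : TangentSpace 𝓘(ℝ, E) (γ t) :=
  mfderiv 𝓘(ℝ, ℝ) 𝓘(ℝ, E) γ t (1 : ℝ)

/-- The coordinate expression, in the chart centred at `γ(t)`, of the curve `γ` near time `t`. -/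
def coordCurve (E : Type*) [NormedAddCommGroup E] [NormedSpace ℝ E] {M : Type*} [MetricSpace M]
    [ChartedSpace E M] (γ : ℝ → M) (t : ℝ) : ℝ → E :=
  fun s => extChartAt 𝓘(ℝ, E) (γ t) (γ s)

/-- The coordinate expression, in the chart centred at `γ(t)`, of a vector field `V` along the
curve `γ`, near time `t`. -/
def coordField (γ : ℝ → M) (V : ∀ s, TangentSpace 𝓘(ℝ, E) (γ s)) (t : ℝ) : ℝ → E :=
  fun s => mfderiv 𝓘(ℝ, E) 𝓘(ℝ, E) (extChartAt 𝓘(ℝ, E) (γ t)) (γ s) (V s)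

variable [RiemannianBundle (fun x : M => TangentSpace 𝓘(ℝ, E) x)]

/-- The metric tensor in the chart `φ` centred at `p`: the function
`z ↦ g(dφ⁻¹_z u, dφ⁻¹_z w)` of the coordinate point `z`, for fixed `u` and `w`. -/
def metricCoeff (p : M) (u w z : E) : ℝ :=
  inner ℝ (mfderiv 𝓘(ℝ, E) 𝓘(ℝ, E) (extChartAt 𝓘(ℝ, E) p).symm z u)
    (mfderiv 𝓘(ℝ, E) 𝓘(ℝ, E) (extChartAt 𝓘(ℝ, E) p).symm z w)

/-- The Christoffel symbol of the first kind `Γ(u, w; a) = g(∇_u w, a)` of the Levi-Civita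
connection (for vector fields `u`, `w`, `a` that are constant in the chart centred at `p`):
`(∂_u g(w, a) + ∂_w g(u, a) - ∂_a g(u, w)) / 2`. -/
def christoffel (p : M) (z u w a : E) : ℝ :=
  (fderiv ℝ (metricCoeff p w a) z u + fderiv ℝ (metricCoeff p u a) z w
    - fderiv ℝ (metricCoeff p u w) z a) / 2

/-- The vector field `V` along the curve `γ` is parallel for the Levi-Civita connection: at each
time `t`, in the chart centred at `γ(t)`, `g(V', a) + Γ(γ', V; a) = 0` for all `a`; that is,
`∇_{γ'} V = 0`. -/
def IsParallelAlong (γ : ℝ → M) (V : ∀ s, TangentSpace 𝓘(ℝ, E) (γ s)) : Prop :=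
  ∀ t, DifferentiableAt ℝ (coordField γ V t) t ∧
    ∀ a : E,
      metricCoeff (γ t) (deriv (coordField γ V t) t) a (coordCurve E γ t t)
        + christoffel (γ t) (coordCurve E γ t t) (deriv (coordCurve E γ t) t)
            (coordField γ V t t) a = 0

variable (E) in
/-- A geodesic, defined for all times: a smooth curve with parallel velocity. -/
def IsGeodesic (γ : ℝ → M) : Prop :=
  ContMDiff 𝓘(ℝ, ℝ) 𝓘(ℝ, E) ∞ γ ∧ IsParallelAlong (E := E) γ (velocity γ)

variable (E M) in
/-- Any two points of `M` determine a unique geodesic `γ` with `γ(0) = x` and `γ(1) = y`. -/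
def UniqueGeodesics : Prop :=
  ∀ x y : M, ∃! γ : ℝ → M, IsGeodesic E γ ∧ γ 0 = x ∧ γ 1 = y

/-- `y = exp_x(u)`: the point `y` is `γ(1)` for the geodesic `γ` with `γ(0) = x` and
`γ'(0) = u`. -/
def IsExp (x : M) (u : TangentSpace 𝓘(ℝ, E) x) (y : M) : Prop :=
  ∃ γ : ℝ → M, IsGeodesic E γ ∧
    (⟨γ 0, velocity γ 0⟩ : TangentBundle 𝓘(ℝ, E) M) = ⟨x, u⟩ ∧ γ 1 = y

/-- `v = Γ_y^x w`: the vector `v ∈ T_x M` is the parallel transport of `w ∈ T_y M` along the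
geodesic from `y` to `x`. -/
def IsParallelTransport (y x : M) (w : TangentSpace 𝓘(ℝ, E) y) (v : TangentSpace 𝓘(ℝ, E) x) :
    Prop :=
  ∃ (γ : ℝ → M) (V : ∀ s, TangentSpace 𝓘(ℝ, E) (γ s)), IsGeodesic E γ ∧ IsParallelAlong γ V ∧
    (⟨γ 0, V 0⟩ : TangentBundle 𝓘(ℝ, E) M) = ⟨y, w⟩ ∧
    (⟨γ 1, V 1⟩ : TangentBundle 𝓘(ℝ, E) M) = ⟨x, v⟩

variable [FiniteDimensional ℝ E]

/-- The Riemannian gradient: the vector `grad f(x) ∈ T_x M` with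
`⟨grad f(x), v⟩ = df_x(v)` for all `v ∈ T_x M`. -/
def grad (f : M → ℝ) (x : M) : TangentSpace 𝓘(ℝ, E) x :=
  have : FiniteDimensional ℝ (TangentSpace 𝓘(ℝ, E) x) := inferInstanceAs (FiniteDimensional ℝ E)
  have : CompleteSpace (TangentSpace 𝓘(ℝ, E) x) := FiniteDimensional.complete ℝ _
  (InnerProductSpace.toDual ℝ (TangentSpace 𝓘(ℝ, E) x)).symm (mfderiv 𝓘(ℝ, E) 𝓘(ℝ, ℝ) f x)

theorem inner_grad (f : M → ℝ) (x : M) (v : TangentSpace 𝓘(ℝ, E) x) :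
    inner ℝ (grad f x) v = (mfderiv 𝓘(ℝ, E) 𝓘(ℝ, ℝ) f x v : ℝ) := by
  have : FiniteDimensional ℝ (TangentSpace 𝓘(ℝ, E) x) := inferInstanceAs (FiniteDimensional ℝ E)
  have : CompleteSpace (TangentSpace 𝓘(ℝ, E) x) := FiniteDimensional.complete ℝ _
  exact InnerProductSpace.toDual_symm_apply

variable (E)

/-- `f` is `μ`-gradient dominated, with minimum value `fstar`. -/
def IsGradientDominated (μ : ℝ) (f : M → ℝ) (fstar : ℝ) : Prop :=
  IsLeast (Set.range f) fstar ∧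
    ∀ x, 2 * μ * (f x - fstar) ≤ inner ℝ (grad (E := E) f x) (grad (E := E) f x)

/-- The gradient of `f` is `L`-Lipschitz: for all `x` and `y`, with `v = Γ_y^x (grad f(y))`,
`⟨grad f(x) - v, grad f(x) - v⟩ ≤ L² d(x, y)²`. -/
def HasLipschitzGrad (L : ℝ) (f : M → ℝ) : Prop :=
  ∀ x y : M, ∃ v : TangentSpace 𝓘(ℝ, E) x, IsParallelTransport y x (grad f y) v ∧
    inner ℝ (grad f x - v) (grad f x - v) ≤ L ^ 2 * dist x y ^ 2

end Geometry

/-- The σ-algebra generated by `x_0, …, x_t`. -/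
@[reducible] def pastSigma {Ω M : Type*} [MeasurableSpace M] (x : ℕ → Ω → M) (t : ℕ) : MeasurableSpace Ω :=
  ⨆ k ≤ t, MeasurableSpace.comap (x k) inferInstance

end

end RiemannianSGD

namespace RiemannianSGD

/-! ### Parallel fields and the metric in coordinates -/

section Geometry

variable {E : Type*} [NormedAddCommGroup E] [NormedSpace ℝ E]
  {M : Type*} [MetricSpace M] [ChartedSpace E M] [IsManifold 𝓘(ℝ, E) ∞ M]

/-! The core is the descent inequality `f y ≤ f x + ⟨grad f x, u⟩ + L/2 ‖u‖²` for `y = exp_x u`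
(`HasLipschitzGrad.descent`). Along a geodesic the derivative of `f` is `⟨grad f, γ'⟩`. Since `γ'`
is parallel and parallel transport preserves inner products, the Lipschitz condition bounds the
growth of this derivative by `L s ‖γ'‖²`. Metric compatibility is derived from the coordinate
definition of the connection (`IsParallelAlong.hasDerivAt_inner`).

For `u = -α(grad f + δ)` with `Lα ≤ 1/4`, the inequality gives a decrease of at least `α/4 ‖grad f‖²
- α ‖δ‖²`. Gradient domination turns this into a contraction of the gap by `ρ` up to `α ‖δ‖²`, for
every outcome. Taking expectations leaves a scalar recursion. Only the mean of `‖δ‖²` enters: no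
unbiasedness is needed. -/

theorem differentiableAt_coordCurve {γ : ℝ → M} {t : ℝ} (hγ : MDifferentiableAt 𝓘(ℝ, ℝ) 𝓘(ℝ, E) γ t) :
    DifferentiableAt ℝ (coordCurve E γ t) t := by
  have h : MDifferentiableAt 𝓘(ℝ, E) 𝓘(ℝ, E) (extChartAt 𝓘(ℝ, E) (γ t)) (γ t) :=
    mdifferentiableAt_extChartAt (mem_chart_source E (γ t))
  exact (h.comp t hγ).differentiableAt

/-- The chart differential and the differential of the inverse chart are mutually inverse. -/
theorem mfderiv_extChartAt_symm_apply_mfderiv (p y : M) (hy : y ∈ (extChartAt 𝓘(ℝ, E) p).source)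
    (v : TangentSpace 𝓘(ℝ, E) y) :
    (⟨(extChartAt 𝓘(ℝ, E) p).symm (extChartAt 𝓘(ℝ, E) p y),
      mfderiv 𝓘(ℝ, E) 𝓘(ℝ, E) (extChartAt 𝓘(ℝ, E) p).symm (extChartAt 𝓘(ℝ, E) p y)
        (mfderiv 𝓘(ℝ, E) 𝓘(ℝ, E) (extChartAt 𝓘(ℝ, E) p) y v)⟩ : TangentBundle 𝓘(ℝ, E) M)
      = ⟨y, v⟩ := by
  have h := mfderivWithin_extChartAt_symm_comp_mfderiv_extChartAt' (I := 𝓘(ℝ, E)) hy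
  rw [modelWithCornersSelf_coe, Set.range_id, mfderivWithin_univ] at h
  have h1 := DFunLike.congr_fun h v
  have h2 := (extChartAt 𝓘(ℝ, E) p).left_inv hy
  refine Bundle.TotalSpace.ext h2 (heq_of_eq ?_)
  exact h1

/-- The inverse chart differential, as a map into the tangent bundle, is smooth. -/
theorem contMDiffAt_mfderiv_extChartAt_symm (p : M) {z : E}
    (hz : z ∈ (extChartAt 𝓘(ℝ, E) p).target) {F : Type*} [NormedAddCommGroup F] [NormedSpace ℝ F]
    {c u : F → E} {q : F} (hc : ContDiffAt ℝ 1 c q) (hu : ContDiffAt ℝ 1 u q) (hq : c q = z) :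
    ContMDiffAt 𝓘(ℝ, F) 𝓘(ℝ, E).tangent 1
      (fun r => (⟨(extChartAt 𝓘(ℝ, E) p).symm (c r),
        mfderiv 𝓘(ℝ, E) 𝓘(ℝ, E) (extChartAt 𝓘(ℝ, E) p).symm (c r) (u r)⟩ :
          TangentBundle 𝓘(ℝ, E) M)) q := by
  subst hq
  have ho : IsOpen (extChartAt 𝓘(ℝ, E) p).target := isOpen_extChartAt_target p
  have h1 : ContMDiffOn 𝓘(ℝ, E) 𝓘(ℝ, E) ∞ (extChartAt 𝓘(ℝ, E) p).symm
    (extChartAt 𝓘(ℝ, E) p).target := contMDiffOn_extChartAt_symm p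
  -- The tangent map costs one derivative. On the open target, derivatives within the target are
  -- full derivatives.
  have h2 := h1.contMDiffOn_tangentMapWithin (m := 1) (by norm_cast) ho.uniqueMDiffOn
  have h3 : ContMDiffAt 𝓘(ℝ, F) 𝓘(ℝ, E).tangent 1
      (fun r => (⟨c r, u r⟩ : TangentBundle 𝓘(ℝ, E) E)) q := by
    rw [Bundle.contMDiffAt_totalSpace]
    refine ⟨hc.contMDiffAt, ?_⟩
    simpa using hu.contMDiffAt
  have h4 : ContMDiffAt 𝓘(ℝ, E).tangent 𝓘(ℝ, E).tangent 1 
     (tangentMapWithin 𝓘(ℝ, E) 𝓘(ℝ, E) (extChartAt 𝓘(ℝ, E) p).symm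
      (extChartAt 𝓘(ℝ, E) p).target) (⟨c q, u q⟩ : TangentBundle 𝓘(ℝ, E) E) := by
    refine h2.contMDiffAt ?_
    exact (FiberBundle.continuous_proj E (TangentSpace 𝓘(ℝ, E))).continuousAt.preimage_mem_nhds
      (ho.mem_nhds hz)
  refine (h4.comp q h3).congr_of_eventuallyEq ?_
  filter_upwards [hc.continuousAt.preimage_mem_nhds (ho.mem_nhds hz)] with r hr
  simp only [Function.comp, tangentMapWithin]
  rw [mfderivWithin_of_mem_nhds (ho.mem_nhds hr)]

variable [RiemannianBundle (fun x : M => TangentSpace 𝓘(ℝ, E) x)]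

theorem metricCoeff_chart (p y : M) (hy : y ∈ (extChartAt 𝓘(ℝ, E) p).source)
    (v w : TangentSpace 𝓘(ℝ, E) y) :
    metricCoeff (E := E) p (mfderiv 𝓘(ℝ, E) 𝓘(ℝ, E) (extChartAt 𝓘(ℝ, E) p) y v)
      (mfderiv 𝓘(ℝ, E) 𝓘(ℝ, E) (extChartAt 𝓘(ℝ, E) p) y w) (extChartAt 𝓘(ℝ, E) p y)
      = inner ℝ v w := by
  -- The base point `φ⁻¹(φ y)` equals `y` only propositionally, so vectors are compared in the total
  -- space.
  have key : ∀ (q : M) (_ : q = y) (v' w' : TangentSpace 𝓘(ℝ, E) q),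
      (⟨q, v'⟩ : TangentBundle 𝓘(ℝ, E) M) = ⟨y, v⟩ →
      (⟨q, w'⟩ : TangentBundle 𝓘(ℝ, E) M) = ⟨y, w⟩ → (inner ℝ v' w' : ℝ) = inner ℝ v w := by
    rintro q rfl v' w' hv hw
    rw [Bundle.TotalSpace.mk_inj.1 hv, Bundle.TotalSpace.mk_inj.1 hw]
  exact key _ ((extChartAt 𝓘(ℝ, E) p).left_inv hy) _ _
    (mfderiv_extChartAt_symm_apply_mfderiv p y hy v)
    (mfderiv_extChartAt_symm_apply_mfderiv p y hy w)

omit [IsManifold 𝓘(ℝ, E) ∞ M] in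
theorem metricCoeff_comm (p : M) (u w z : E) : metricCoeff p u w z = metricCoeff p w u z :=
  real_inner_comm _ _

omit [IsManifold 𝓘(ℝ, E) ∞ M] in
theorem metricCoeff_add_smul (p : M) (u v w z : E) (s : ℝ) :
    metricCoeff p (u + s • v) w z = metricCoeff p u w z + s * metricCoeff p v w z := by
  have h := (mfderiv 𝓘(ℝ, E) 𝓘(ℝ, E) (extChartAt 𝓘(ℝ, E) p).symm z).map_add u (s • v)
  have h' := (mfderiv 𝓘(ℝ, E) 𝓘(ℝ, E) (extChartAt 𝓘(ℝ, E) p).symm z).map_smul s v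
  exact (congrArg (fun a => (inner ℝ a _ : ℝ)) (h.trans (congrArg _ h'))).trans
    ((inner_add_left _ _ _).trans (congrArg _ (real_inner_smul_left _ _ _)))

variable [IsContMDiffRiemannianBundle 𝓘(ℝ, E) ∞ E (fun x : M => TangentSpace 𝓘(ℝ, E) x)]

theorem contDiffAt_metricCoeff (p : M) {z : E} (hz : z ∈ (extChartAt 𝓘(ℝ, E) p).target)
    {F : Type*} [NormedAddCommGroup F] [NormedSpace ℝ F] {c u w : F → E} {q : F}
    (hc : ContDiffAt ℝ 1 c q) (hu : ContDiffAt ℝ 1 u q) (hw : ContDiffAt ℝ 1 w q) (hq : c q = z) :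
    ContDiffAt ℝ 1 (fun r => metricCoeff p (u r) (w r) (c r)) q := by
  rw [← contMDiffAt_iff_contDiffAt]
  exact ContMDiffAt.inner_bundle (contMDiffAt_mfderiv_extChartAt_symm p hz hc hu hq)
    (contMDiffAt_mfderiv_extChartAt_symm p hz hc hw hq)

/-- Product rule for `g_c(V, W)`: the derivative of the jointly C¹ function `F` splits into three
partial derivatives. In the vector slots `F` is linear, so restriction to an affine line identifies
them. -/
theorem hasDerivAt_metricCoeff (p : M) {c V W : ℝ → E} {t : ℝ}
    (hz : c t ∈ (extChartAt 𝓘(ℝ, E) p).target) (hc : DifferentiableAt ℝ c t)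
    (hV : DifferentiableAt ℝ V t) (hW : DifferentiableAt ℝ W t) :
    HasDerivAt (fun s => metricCoeff p (V s) (W s) (c s))
      (fderiv ℝ (metricCoeff p (V t) (W t)) (c t) (deriv c t)
        + metricCoeff p (deriv V t) (W t) (c t) + metricCoeff p (V t) (deriv W t) (c t)) t := by
  set F : E × E × E → ℝ := fun q => metricCoeff p q.2.1 q.2.2 q.1
  have hF : HasFDerivAt F (fderiv ℝ F (c t, V t, W t)) (c t, V t, W t) :=
    ((contDiffAt_metricCoeff p (q := (c t, V t, W t)) hz contDiffAt_fst
      (contDiffAt_fst.comp _ contDiffAt_snd) (contDiffAt_snd.comp _ contDiffAt_snd)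
      rfl).differentiableAt one_ne_zero).hasFDerivAt
  set D := fderiv ℝ F (c t, V t, W t)
  have h0 : HasDerivAt (fun s => F (c s, V s, W s)) (D (deriv c t, deriv V t, deriv W t)) t :=
    HasFDerivAt.comp_hasDerivAt (f := fun s => (c s, V s, W s)) t hF (hc.hasDerivAt.prodMk (hV.hasDerivAt.prodMk hW.hasDerivAt))
  have h1 : D (deriv c t, 0, 0) = fderiv ℝ (metricCoeff p (V t) (W t)) (c t) (deriv c t) := by
    have h : HasFDerivAt (fun z => F (z, V t, W t))
        (D.comp ((ContinuousLinearMap.id ℝ E).prod (0 : E →L[ℝ] E × E))) (c t) :=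
      HasFDerivAt.comp (f := fun z => (z, V t, W t)) (c t) hF
        ((hasFDerivAt_id (c t)).prodMk (hasFDerivAt_const (V t, W t) (c t)))
    rw [show metricCoeff p (V t) (W t) = fun z => F (z, V t, W t) from rfl, h.fderiv]
    rfl
  have line : ∀ (u w : E) (a : E),
      HasDerivAt (fun s : ℝ => metricCoeff p (u + s • a) w (c t)) (metricCoeff p a w (c t)) 0 := by
    intro u w a
    simp only [metricCoeff_add_smul]
    simpa using ((hasDerivAt_id (0 : ℝ)).mul_const (metricCoeff p a w (c t))).const_add
      (metricCoeff p u w (c t))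
  have aff : ∀ u a : E, HasDerivAt (fun s : ℝ => u + s • a) a 0 := by
    intro u a
    simpa using ((hasDerivAt_id (0 : ℝ)).smul_const a).const_add u
  have h2 : D (0, deriv V t, 0) = metricCoeff p (deriv V t) (W t) (c t) := by
    refine HasDerivAt.unique (x := (0 : ℝ)) (f := fun s : ℝ => F (c t, V t + s • deriv V t, W t)) ?_ (line _ _ _)
    have := (hasDerivAt_const (0 : ℝ) (c t)).prodMk
      ((aff (V t) (deriv V t)).prodMk (hasDerivAt_const (0 : ℝ) (W t)))
    exact HasFDerivAt.comp_hasDerivAt (0 : ℝ) (by simpa using hF) this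
  have h3 : D (0, 0, deriv W t) = metricCoeff p (V t) (deriv W t) (c t) := by
    rw [metricCoeff_comm]
    refine HasDerivAt.unique (x := (0 : ℝ)) (f := fun s : ℝ => F (c t, V t, W t + s • deriv W t)) ?_ ?_
    · have := (hasDerivAt_const (0 : ℝ) (c t)).prodMk
        ((hasDerivAt_const (0 : ℝ) (V t)).prodMk (aff (W t) (deriv W t)))
      exact HasFDerivAt.comp_hasDerivAt (0 : ℝ) (by simpa using hF) this
    · refine (line (W t) (V t) (deriv W t)).congr_of_eventuallyEq (.of_forall fun s => ?_)
      exact metricCoeff_comm _ _ _ _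
  have hsum : (deriv c t, deriv V t, deriv W t)
      = (deriv c t, 0, 0) + (0, deriv V t, 0) + (0, 0, deriv W t) := by simp
  rw [hsum, map_add, map_add, h1, h2, h3] at h0
  exact h0

/-- The Levi-Civita connection is metric: scalar products of parallel fields are constant. -/
theorem IsParallelAlong.hasDerivAt_inner {γ : ℝ → M} {V W : ∀ s, TangentSpace 𝓘(ℝ, E) (γ s)}
    (hγ : MDifferentiable 𝓘(ℝ, ℝ) 𝓘(ℝ, E) γ) (hV : IsParallelAlong γ V)
    (hW : IsParallelAlong γ W) (t : ℝ) : HasDerivAt (fun s => (inner ℝ (V s) (W s) : ℝ)) 0 t := by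
  have h := hasDerivAt_metricCoeff (γ t) (c := coordCurve E γ t) (t := t)
    (mem_extChartAt_target (γ t)) (differentiableAt_coordCurve (hγ t)) (hV t).1 (hW t).1
  have e1 := (hV t).2 (coordField γ W t t)
  have e2 := (hW t).2 (coordField γ V t t)
  -- Adding `Γ(γ', V; W)` and `Γ(γ', W; V)` cancels all but `∂_{γ'} g(V, W)`, by symmetry of `g`.
  have hzero : fderiv ℝ (metricCoeff (γ t) (coordField γ V t t) (coordField γ W t t))
        (coordCurve E γ t t) (deriv (coordCurve E γ t) t)
      + metricCoeff (γ t) (deriv (coordField γ V t) t) (coordField γ W t t) (coordCurve E γ t t)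
      + metricCoeff (γ t) (coordField γ V t t) (deriv (coordField γ W t) t)
        (coordCurve E γ t t) = 0 := by
    have hc : ∀ u w : E, metricCoeff (γ t) u w = metricCoeff (γ t) w u :=
      fun u w => funext (metricCoeff_comm (γ t) u w)
    simp only [christoffel] at e1 e2
    rw [hc (coordField γ W t t) (coordField γ V t t)] at e2
    rw [hc (coordField γ V t t) (deriv (coordField γ W t) t)]
    linarith
  rw [hzero] at h
  refine h.congr_of_eventuallyEq ?_
  filter_upwards [(hγ t).continuousAt.preimage_mem_nhds (extChartAt_source_mem_nhds (I := 𝓘(ℝ, E))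
    (γ t))] with s hs
  exact (metricCoeff_chart (γ t) (γ s) hs (V s) (W s)).symm

theorem IsParallelAlong.inner_eq {γ : ℝ → M} {V W : ∀ s, TangentSpace 𝓘(ℝ, E) (γ s)}
    (hγ : MDifferentiable 𝓘(ℝ, ℝ) 𝓘(ℝ, E) γ) (hV : IsParallelAlong γ V)
    (hW : IsParallelAlong γ W) (s t : ℝ) :
    (inner ℝ (V s) (W s) : ℝ) = inner ℝ (V t) (W t) :=
  is_const_of_deriv_eq_zero (fun t => (hV.hasDerivAt_inner hγ hW t).differentiableAt)
    (fun t => (hV.hasDerivAt_inner hγ hW t).deriv) s t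

end Geometry

/-! ### Affine changes of time -/

section Reparametrization

variable {E : Type*} [NormedAddCommGroup E] [NormedSpace ℝ E]
  {M : Type*} [MetricSpace M] [ChartedSpace E M]

theorem velocity_comp_affine {γ : ℝ → M} (hγ : MDifferentiable 𝓘(ℝ, ℝ) 𝓘(ℝ, E) γ) (a b r : ℝ) :
    velocity (E := E) (fun r => γ (a * r + b)) r = a • velocity (E := E) γ (a * r + b) := by
  have h : HasDerivAt (fun r : ℝ => a * r + b) a r := by
    simpa using ((hasDerivAt_id r).const_mul a).add_const b
  have h1 : mfderiv 𝓘(ℝ, ℝ) 𝓘(ℝ, E) (γ ∘ fun r => a * r + b) r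
      = (mfderiv 𝓘(ℝ, ℝ) 𝓘(ℝ, E) γ (a * r + b)).comp
        (mfderiv 𝓘(ℝ, ℝ) 𝓘(ℝ, ℝ) (fun r : ℝ => a * r + b) r) :=
    mfderiv_comp r (hγ _) h.differentiableAt.mdifferentiableAt
  have h2 : mfderiv 𝓘(ℝ, ℝ) 𝓘(ℝ, ℝ) (fun r : ℝ => a * r + b) r (1 : ℝ) = a • (1 : ℝ) := by
    rw [mfderiv_eq_fderiv]
    exact fderiv_apply_one_eq_deriv.trans (h.deriv.trans (mul_one a).symm)
  refine (DFunLike.congr_fun h1 (1 : ℝ)).trans ?_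
  refine (congrArg (mfderiv 𝓘(ℝ, ℝ) 𝓘(ℝ, E) γ (a * r + b)) h2).trans ?_
  exact (mfderiv 𝓘(ℝ, ℝ) 𝓘(ℝ, E) γ (a * r + b)).map_smul a (1 : ℝ)

theorem coordField_smul_comp (γ : ℝ → M) (V : ∀ s, TangentSpace 𝓘(ℝ, E) (γ s)) (a b k t : ℝ) :
    coordField (E := E) (fun r => γ (a * r + b)) (fun r => k • V (a * r + b)) t
      = fun r => k • coordField γ V (a * t + b) (a * r + b) := by
  funext r
  exact (mfderiv 𝓘(ℝ, E) 𝓘(ℝ, E) (extChartAt 𝓘(ℝ, E) (γ (a * t + b))) (γ (a * r + b))).map_smul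
    k (V (a * r + b))

theorem hasDerivAt_comp_affine {f : ℝ → E} {f' : E} {a b t : ℝ} (h : HasDerivAt f f' (a * t + b)) :
    HasDerivAt (fun r => f (a * r + b)) (a • f') t :=
  HasDerivAt.scomp (h := fun r => a * r + b) t h
    (by simpa using ((hasDerivAt_id t).const_mul a).add_const b)

variable [RiemannianBundle (fun x : M => TangentSpace 𝓘(ℝ, E) x)]

theorem metricCoeff_smul_left (p : M) (k : ℝ) (u w z : E) :
    metricCoeff p (k • u) w z = k * metricCoeff p u w z := by
  have h := (mfderiv 𝓘(ℝ, E) 𝓘(ℝ, E) (extChartAt 𝓘(ℝ, E) p).symm z).map_smul k u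
  exact (congrArg (fun a => (inner ℝ a _ : ℝ)) h).trans (real_inner_smul_left _ _ _)

theorem christoffel_smul_left (p : M) (k : ℝ) (z u w a : E) :
    christoffel p z (k • u) w a = k * christoffel p z u w a := by
  have h : ∀ v : E, metricCoeff p (k • u) v = k • metricCoeff p u v :=
    fun v => funext fun z => metricCoeff_smul_left p k u v z
  simp only [christoffel, h, map_smul, fderiv_const_smul_field, smul_eq_mul]
  simp
  ring

theorem christoffel_smul_right (p : M) (k : ℝ) (z u w a : E) :
    christoffel p z u (k • w) a = k * christoffel p z u w a := by
  have h : ∀ v : E, metricCoeff p (k • w) v = k • metricCoeff p w v :=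
    fun v => funext fun z => metricCoeff_smul_left p k w v z
  have h' : metricCoeff p u (k • w) = k • metricCoeff p u w := funext fun z => by
    rw [metricCoeff_comm, metricCoeff_smul_left, metricCoeff_comm]; rfl
  simp only [christoffel, h, h', map_smul, fderiv_const_smul_field]
  simp
  ring

/-- Parallel fields stay parallel under an affine change of time and multiplication by a
constant. -/
theorem IsParallelAlong.smul_comp_affine {γ : ℝ → M} {V : ∀ s, TangentSpace 𝓘(ℝ, E) (γ s)}
    [IsManifold 𝓘(ℝ, E) ∞ M]
    (hγ : MDifferentiable 𝓘(ℝ, ℝ) 𝓘(ℝ, E) γ) (hV : IsParallelAlong γ V) (a b k : ℝ) :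
    IsParallelAlong (E := E) (fun r => γ (a * r + b)) (fun r => k • V (a * r + b)) := by
  intro t
  obtain ⟨hd, he⟩ := hV (a * t + b)
  have h1 : HasDerivAt (fun r => k • coordField γ V (a * t + b) (a * r + b))
      (k • a • deriv (coordField γ V (a * t + b)) (a * t + b)) t :=
    (hasDerivAt_comp_affine hd.hasDerivAt).const_smul k
  have h2 : HasDerivAt (coordCurve E (fun r => γ (a * r + b)) t)
      (a • deriv (coordCurve E γ (a * t + b)) (a * t + b)) t :=
    hasDerivAt_comp_affine (differentiableAt_coordCurve (hγ (a * t + b))).hasDerivAt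
  rw [coordField_smul_comp]
  refine ⟨h1.differentiableAt, fun v => ?_⟩
  have h3 := he v
  -- Both terms of the parallel equation acquire the factor `k * a`.
  rw [h1.deriv, h2.deriv, metricCoeff_smul_left, metricCoeff_smul_left, christoffel_smul_left,
    christoffel_smul_right]
  change k * (a * metricCoeff (γ (a * t + b)) _ v (coordCurve E γ (a * t + b) (a * t + b)))
    + a * (k * christoffel (γ (a * t + b)) (coordCurve E γ (a * t + b) (a * t + b)) _ _ v) = 0
  linear_combination k * a * h3

/-- Negative `a` is allowed, so geodesics can be reversed. The new velocity is `a` times the old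
one, whence `k = a`. -/
theorem IsGeodesic.comp_affine {γ : ℝ → M} [IsManifold 𝓘(ℝ, E) ∞ M]
    (hγ : IsGeodesic E γ) (a b : ℝ) : IsGeodesic E (fun r => γ (a * r + b)) := by
  have hd : MDifferentiable 𝓘(ℝ, ℝ) 𝓘(ℝ, E) γ := hγ.1.mdifferentiable (by simp)
  refine ⟨hγ.1.comp (contDiff_const.mul contDiff_id |>.add contDiff_const).contMDiff, ?_⟩
  rw [show velocity (E := E) (fun r => γ (a * r + b)) = fun r => a • velocity (E := E) γ (a * r + b)
    from funext fun r => velocity_comp_affine hd a b r]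
  exact hγ.2.smul_comp_affine hd a b a

end Reparametrization

/-! ### The descent lemma and one gradient step -/

section Descent

variable {E : Type*} [NormedAddCommGroup E] [NormedSpace ℝ E]
  {M : Type*} [MetricSpace M] [ChartedSpace E M] [IsManifold 𝓘(ℝ, E) ∞ M]
  [RiemannianBundle (fun x : M => TangentSpace 𝓘(ℝ, E) x)]
  [IsContMDiffRiemannianBundle 𝓘(ℝ, E) ∞ E (fun x : M => TangentSpace 𝓘(ℝ, E) x)]

omit [IsManifold 𝓘(ℝ, E) ∞ M]
  [IsContMDiffRiemannianBundle 𝓘(ℝ, E) ∞ E (fun x : M => TangentSpace 𝓘(ℝ, E) x)] in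
theorem IsGeodesic.mdifferentiable {γ : ℝ → M} (hγ : IsGeodesic E γ) :
    MDifferentiable 𝓘(ℝ, ℝ) 𝓘(ℝ, E) γ :=
  hγ.1.mdifferentiable (by simp)

/-- Geodesics have constant speed. -/
theorem IsGeodesic.norm_velocity {γ : ℝ → M} (hγ : IsGeodesic E γ) (s t : ℝ) :
    ‖velocity (E := E) γ s‖ = ‖velocity (E := E) γ t‖ := by
  have h := hγ.2.inner_eq hγ.mdifferentiable hγ.2 s t
  rw [real_inner_self_eq_norm_sq, real_inner_self_eq_norm_sq] at h
  exact (sq_eq_sq₀ (norm_nonneg _) (norm_nonneg _)).1 h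

/-- Distance is at most length, and the speed is constant. -/
theorem IsGeodesic.dist_le [IsRiemannianManifold 𝓘(ℝ, E) M] {γ : ℝ → M} (hγ : IsGeodesic E γ)
    {a b : ℝ} (hab : a ≤ b) : dist (γ a) (γ b) ≤ (b - a) * ‖velocity (E := E) γ 0‖ := by
  have h1 : edist (γ a) (γ b) ≤ ENNReal.ofReal ((b - a) * ‖velocity (E := E) γ 0‖) := by
    rw [IsRiemannianManifold.out (I := 𝓘(ℝ, E)) (γ a) (γ b)]
    refine (Manifold.riemannianEDist_le_pathELength
      ((hγ.1.of_le (by simp)).contMDiffOn) rfl rfl hab).trans ?_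
    rw [Manifold.pathELength_eq_lintegral_mfderiv_Icc]
    have h2 : ∀ t, ‖mfderiv 𝓘(ℝ, ℝ) 𝓘(ℝ, E) γ t 1‖ₑ
        = ENNReal.ofReal ‖velocity (E := E) γ 0‖ := fun t => by
      rw [← hγ.norm_velocity t 0, ofReal_norm]; rfl
    simp only [h2]
    rw [setLIntegral_const, Real.volume_Icc, mul_comm,
      ENNReal.ofReal_mul (sub_nonneg.2 hab)]
  rw [edist_dist] at h1
  exact (ENNReal.ofReal_le_ofReal_iff
    (mul_nonneg (sub_nonneg.2 hab) (norm_nonneg _))).1 h1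

/-- Parallel transport along the unique geodesic preserves scalar products with parallel fields. -/
theorem IsParallelTransport.inner_eq (hgeo : UniqueGeodesics E M) {τ : ℝ → M}
    (hτ : IsGeodesic E τ) {W : ∀ s, TangentSpace 𝓘(ℝ, E) (τ s)} (hW : IsParallelAlong τ W)
    {w : TangentSpace 𝓘(ℝ, E) (τ 0)} {v : TangentSpace 𝓘(ℝ, E) (τ 1)}
    (h : IsParallelTransport (τ 0) (τ 1) w v) : (inner ℝ v (W 1) : ℝ) = inner ℝ w (W 0) := by
  obtain ⟨γ, V, hγ, hV, h0, h1⟩ := h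
  -- Uniqueness identifies the geodesic hidden in the transport with `τ`.
  obtain rfl : γ = τ := (hgeo (τ 0) (τ 1)).unique
    ⟨hγ, congrArg TotalSpace.proj h0, congrArg TotalSpace.proj h1⟩ ⟨hτ, rfl, rfl⟩
  rw [← TotalSpace.mk_inj.1 h0, ← TotalSpace.mk_inj.1 h1]
  exact hV.inner_eq hγ.mdifferentiable hW 1 0

variable [FiniteDimensional ℝ E]

omit [IsManifold 𝓘(ℝ, E) ∞ M]
  [IsContMDiffRiemannianBundle 𝓘(ℝ, E) ∞ E (fun x : M => TangentSpace 𝓘(ℝ, E) x)] in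
theorem hasDerivAt_comp_curve {f : M → ℝ} (hf : MDifferentiable 𝓘(ℝ, E) 𝓘(ℝ, ℝ) f) {γ : ℝ → M}
    (hγ : MDifferentiable 𝓘(ℝ, ℝ) 𝓘(ℝ, E) γ) (s : ℝ) :
    HasDerivAt (fun r => f (γ r)) (inner ℝ (grad f (γ s)) (velocity (E := E) γ s)) s := by
  rw [inner_grad]
  have h : HasMFDerivAt 𝓘(ℝ, ℝ) 𝓘(ℝ, ℝ) (f ∘ γ) s
      ((mfderiv 𝓘(ℝ, E) 𝓘(ℝ, ℝ) f (γ s)).comp (mfderiv 𝓘(ℝ, ℝ) 𝓘(ℝ, E) γ s)) :=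
    (hf (γ s)).hasMFDerivAt.comp s (hγ s).hasMFDerivAt
  have h' : HasFDerivAt (fun r => f (γ r)) (show ℝ →L[ℝ] ℝ from
      (mfderiv 𝓘(ℝ, E) 𝓘(ℝ, ℝ) f (γ s)).comp (mfderiv 𝓘(ℝ, ℝ) 𝓘(ℝ, E) γ s)) s := h.hasFDerivAt
  exact h'.hasDerivAt

theorem HasLipschitzGrad.inner_grad_sub_le [IsRiemannianManifold 𝓘(ℝ, E) M]
    (hgeo : UniqueGeodesics E M) {f : M → ℝ} {L : ℝ} (hL : 0 ≤ L) (hlip : HasLipschitzGrad E L f)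
    {γ : ℝ → M} (hγ : IsGeodesic E γ) {s : ℝ} (hs : 0 ≤ s) :
    (inner ℝ (grad f (γ s)) (velocity (E := E) γ s) : ℝ)
      - inner ℝ (grad f (γ 0)) (velocity (E := E) γ 0)
      ≤ L * s * ‖velocity (E := E) γ 0‖ ^ 2 := by
  set n := ‖velocity (E := E) γ 0‖ with hn
  let φ : ℝ → ℝ := fun r => inner ℝ (grad f (γ r)) (velocity (E := E) γ r)
  -- The transport goes from `γ s` back to `γ 0` in unit time. The parallel field `W` is the
  -- velocity of `γ`, not of `τ`, so no factor `-s` appears.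
  let τ : ℝ → M := fun r => γ (-s * r + s)
  have hτ : IsGeodesic E τ := hγ.comp_affine (-s) s
  let W : ∀ r, TangentSpace 𝓘(ℝ, E) (τ r) := fun r => (1 : ℝ) • velocity (E := E) γ (-s * r + s)
  have hW : IsParallelAlong τ W := hγ.2.smul_comp_affine hγ.mdifferentiable (-s) s 1
  obtain ⟨v, hv, hle⟩ := hlip (τ 1) (τ 0)
  have h1 := hv.inner_eq hgeo hτ hW
  have hφ : ∀ r, (inner ℝ (grad f (τ r)) (W r) : ℝ) = φ (-s * r + s) := fun r => by
    change (inner ℝ _ ((1 : ℝ) • velocity (E := E) γ (-s * r + s)) : ℝ) = _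
    rw [one_smul]
  have hφ0 := hφ 0
  have hφ1 := hφ 1
  rw [show -s * 0 + s = s by ring] at hφ0
  rw [show -s * 1 + s = 0 by ring] at hφ1
  have hWn : ‖W 1‖ = n := by
    change ‖(1 : ℝ) • velocity (E := E) γ (-s * 1 + s)‖ = n
    rw [one_smul, hγ.norm_velocity _ 0]
  have hd : dist (τ 1) (τ 0) ≤ s * n := by
    have := hγ.dist_le hs
    rw [sub_zero] at this
    change dist (γ (-s * 1 + s)) (γ (-s * 0 + s)) ≤ s * n
    rwa [show -s * 0 + s = s by ring, show -s * 1 + s = 0 by ring]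
  have hnorm : ‖grad f (τ 1) - v‖ ≤ L * dist (τ 1) (τ 0) := by
    rw [real_inner_self_eq_norm_sq, ← mul_pow] at hle
    exact (sq_le_sq₀ (norm_nonneg _) (mul_nonneg hL dist_nonneg)).1 hle
  have hdiff : φ s - φ 0 = - inner ℝ (grad f (τ 1) - v) (W 1) := by
    rw [inner_sub_left, hφ1, h1, hφ0]; ring
  calc φ s - φ 0 = - inner ℝ (grad f (τ 1) - v) (W 1) := hdiff
    _ ≤ ‖grad f (τ 1) - v‖ * ‖W 1‖ := (neg_le_abs _).trans (abs_real_inner_le_norm _ _)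
    _ ≤ (L * (s * n)) * n := by
      rw [hWn]
      exact mul_le_mul_of_nonneg_right (hnorm.trans (mul_le_mul_of_nonneg_left hd hL))
        (norm_nonneg _)
    _ = L * s * n ^ 2 := by ring

theorem HasLipschitzGrad.descent_along_geodesic [IsRiemannianManifold 𝓘(ℝ, E) M]
    (hgeo : UniqueGeodesics E M) {f : M → ℝ} (hf : MDifferentiable 𝓘(ℝ, E) 𝓘(ℝ, ℝ) f)
    {L : ℝ} (hL : 0 ≤ L) (hlip : HasLipschitzGrad E L f) {γ : ℝ → M} (hγ : IsGeodesic E γ) :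
    f (γ 1) ≤ f (γ 0) + inner ℝ (grad f (γ 0)) (velocity (E := E) γ 0)
      + L / 2 * ‖velocity (E := E) γ 0‖ ^ 2 := by
  set n := ‖velocity (E := E) γ 0‖
  set c : ℝ := inner ℝ (grad f (γ 0)) (velocity (E := E) γ 0)
  -- Monotonicity of this difference replaces integrating the derivative bound, so `grad f` need not
  -- be integrated.
  let g : ℝ → ℝ := fun s => c * s + L / 2 * n ^ 2 * s ^ 2 - f (γ s)
  have hg : ∀ s, HasDerivAt g (c + L * s * n ^ 2
      - inner ℝ (grad f (γ s)) (velocity (E := E) γ s)) s := fun s => by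
    have h := (((hasDerivAt_id s).const_mul c).add
      ((hasDerivAt_pow 2 s).const_mul (L / 2 * n ^ 2))).sub
      (hasDerivAt_comp_curve hf hγ.mdifferentiable s)
    refine h.congr_deriv ?_
    push_cast
    ring
  have hmono : MonotoneOn g (Set.Ici 0) := by
    refine monotoneOn_of_deriv_nonneg (convex_Ici 0)
      (fun s _ => (hg s).continuousAt.continuousWithinAt)
      (fun s _ => (hg s).differentiableAt.differentiableWithinAt) fun s hs => ?_
    rw [interior_Ici] at hs
    rw [(hg s).deriv]
    have := hlip.inner_grad_sub_le hgeo hL hγ (le_of_lt hs)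
    linarith
  have h := hmono (Set.self_mem_Ici) (Set.mem_Ici.2 zero_le_one) zero_le_one
  simp only [g] at h
  linarith

/-- The descent lemma on a Riemannian manifold. -/
theorem HasLipschitzGrad.descent [IsRiemannianManifold 𝓘(ℝ, E) M]
    (hgeo : UniqueGeodesics E M) {f : M → ℝ} (hf : MDifferentiable 𝓘(ℝ, E) 𝓘(ℝ, ℝ) f)
    {L : ℝ} (hL : 0 ≤ L) (hlip : HasLipschitzGrad E L f) {x y : M} {u : TangentSpace 𝓘(ℝ, E) x}
    (h : IsExp x u y) :
    f y ≤ f x + inner ℝ (grad f x) u + L / 2 * ‖u‖ ^ 2 := by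
  obtain ⟨γ, hγ, h0, rfl⟩ := h
  obtain rfl : γ 0 = x := congrArg TotalSpace.proj h0
  rw [← TotalSpace.mk_inj.1 h0]
  exact hlip.descent_along_geodesic hgeo hf hL hγ

/-- One step of gradient descent with an error in the gradient contracts the optimality gap of a
gradient dominated function, up to the squared size of the error. -/
theorem IsGradientDominated.step_le [IsRiemannianManifold 𝓘(ℝ, E) M]
    (hgeo : UniqueGeodesics E M) {f : M → ℝ} (hf : MDifferentiable 𝓘(ℝ, E) 𝓘(ℝ, ℝ) f)
    {μ L fstar : ℝ} (hL : 0 < L) (hdom : IsGradientDominated E μ f fstar)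
    (hlip : HasLipschitzGrad E L f) {α : ℝ} (hα : 0 < α) (hαL : α ≤ 1 / (4 * L))
    {x y : M} {d : TangentSpace 𝓘(ℝ, E) x} (h : IsExp x (-(α • (grad f x + d))) y) :
    f y - fstar ≤ (1 - α * μ / 2) * (f x - fstar) + α * inner ℝ d d := by
  have h1 := hlip.descent hgeo hf hL.le h
  have h2 := hdom.2 x
  set G : TangentSpace 𝓘(ℝ, E) x := grad f x
  rw [inner_neg_right, real_inner_smul_right, norm_neg, norm_smul, mul_pow,
    Real.norm_eq_abs, sq_abs, ← real_inner_self_eq_norm_sq, inner_add_right, real_inner_add_add_self]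
    at h1
  have hp : 0 ≤ (inner ℝ (G + d) (G + d) : ℝ) := real_inner_self_nonneg
  have hm : 0 ≤ (inner ℝ (G - d) (G - d) : ℝ) := real_inner_self_nonneg
  have hd : 0 ≤ (inner ℝ d d : ℝ) := real_inner_self_nonneg
  rw [real_inner_add_add_self] at hp
  rw [real_inner_sub_sub_self] at hm
  have hLα : L * α ≤ 1 / 4 := by
    rw [le_div_iff₀ (by positivity)] at hαL
    linarith
  generalize (inner ℝ G G : ℝ) = a at *
  generalize (inner ℝ G d : ℝ) = b at *
  generalize (inner ℝ d d : ℝ) = e at *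
  -- After this bound, the claim follows from `‖G + d‖² ≥ 0`, `‖G - d‖² ≥ 0`, `‖d‖² ≥ 0` and
  -- gradient domination, each scaled by `α`.
  have h3 : L / 2 * (α ^ 2 * (a + 2 * b + e)) ≤ α / 8 * (a + 2 * b + e) := by
    have := mul_le_mul_of_nonneg_right hLα (mul_nonneg hα.le hp)
    linarith
  have h4 := mul_le_mul_of_nonneg_left h2 hα.le
  have h5 := mul_nonneg hα.le hp
  have h6 := mul_nonneg hα.le hm
  have h7 := mul_nonneg hα.le hd
  linarith

end Descent

/-! ### Scalar recursions -/

theorem le_pow_mul_add_sum_of_le {a ε : ℕ → ℝ} {ρ α : ℝ} (hρ : 0 < ρ)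
    (h : ∀ t, a (t + 1) ≤ ρ * a t + α * ε t) (t : ℕ) :
    a t ≤ ρ ^ t * a 0 + α * ρ ^ t * ∑ ℓ ∈ Finset.range t, ε ℓ * (ρ ^ (ℓ + 1))⁻¹ := by
  induction t with
  | zero => simp
  | succ t ih =>
    refine (h t).trans ((add_le_add_left (mul_le_mul_of_nonneg_left ih hρ.le) _).trans_eq ?_)
    rw [Finset.sum_range_succ, mul_add, mul_add, show α * ρ ^ (t + 1) * (ε t * (ρ ^ (t + 1))⁻¹)
      = α * ε t * (ρ ^ (t + 1) * (ρ ^ (t + 1))⁻¹) by ring, mul_inv_cancel₀ (by positivity)]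
    ring

/-- A nonnegative sequence that contracts up to an error tending to zero tends to zero. -/
theorem tendsto_zero_of_le_mul_add {a b : ℕ → ℝ} {ρ : ℝ} (hρ : 0 ≤ ρ) (hρ1 : ρ < 1)
    (ha : ∀ t, 0 ≤ a t) (h : ∀ t, a (t + 1) ≤ ρ * a t + b t)
    (hb : Filter.Tendsto b Filter.atTop (𝓝 0)) : Filter.Tendsto a Filter.atTop (𝓝 0) := by
  rw [Metric.tendsto_atTop]
  intro η hη
  -- `η / 2` is the fixed point of `r ↦ ρ r + (1 - ρ) η / 2`, so the bound below propagates.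
  have hc : 0 < (1 - ρ) * (η / 2) := mul_pos (by linarith) (by linarith)
  obtain ⟨N, hN⟩ := Filter.eventually_atTop.1 (hb.eventually_le_const hc)
  have hbound : ∀ k, a (N + k) ≤ ρ ^ k * a N + η / 2 := by
    intro k
    induction k with
    | zero => simpa using (half_pos hη).le
    | succ k ih =>
      have h1 := h (N + k)
      have h2 := hN (N + k) (Nat.le_add_right _ _)
      have h3 := mul_le_mul_of_nonneg_left ih hρ
      rw [← add_assoc, pow_succ]
      linarith
  have hpow : Filter.Tendsto (fun k : ℕ => ρ ^ k * a N) Filter.atTop (𝓝 0) := by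
    simpa using (tendsto_pow_atTop_nhds_zero_of_lt_one hρ hρ1).mul_const (a N)
  obtain ⟨K, hK⟩ := Filter.eventually_atTop.1 (hpow.eventually_lt_const (half_pos hη))
  refine ⟨N + K, fun t ht => ?_⟩
  obtain ⟨k, rfl⟩ := Nat.exists_eq_add_of_le ((Nat.le_add_right N K).trans ht)
  have h1 := hbound k
  have h2 := hK k (by omega)
  rw [Real.dist_eq, sub_zero, abs_of_nonneg (ha _)]
  linarith

theorem pastSigma_le {Ω M : Type*} [mΩ : MeasurableSpace Ω] [MeasurableSpace M] {x : ℕ → Ω → M}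
    (hx : ∀ t, Measurable (x t)) (t : ℕ) : pastSigma x t ≤ mΩ :=
  iSup₂_le fun k _ => (hx k).comap_le

end RiemannianSGD

/-! ### Expectations -/

theorem theoremB {E : Type*} [NormedAddCommGroup E] [NormedSpace ℝ E] [FiniteDimensional ℝ E]
    {M : Type*} [MetricSpace M] [ChartedSpace E M] [IsManifold 𝓘(ℝ, E) ∞ M]
    [RiemannianBundle (fun x : M => TangentSpace 𝓘(ℝ, E) x)]
    [IsContMDiffRiemannianBundle 𝓘(ℝ, E) ∞ E (fun x : M => TangentSpace 𝓘(ℝ, E) x)]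
    [IsRiemannianManifold 𝓘(ℝ, E) M] [CompleteSpace M] [ConnectedSpace M]
    [MeasurableSpace M] [BorelSpace M]
    (hgeo : RiemannianSGD.UniqueGeodesics E M)
    (f : M → ℝ) (hf : MDifferentiable 𝓘(ℝ, E) 𝓘(ℝ, ℝ) f)
    (μ L : ℝ) (hμ : 0 < μ) (hμL : μ ≤ L) (fstar : ℝ)
    (hdom : RiemannianSGD.IsGradientDominated E μ f fstar)
    (hlip : RiemannianSGD.HasLipschitzGrad E L f)
    (α : ℝ) (hα : 0 < α) (hαL : α ≤ 1 / (4 * L))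
    {Ω : Type*} [mΩ : MeasurableSpace Ω] (P : Measure Ω) [IsProbabilityMeasure P]
    (x₀ : M) (x : ℕ → Ω → M) (δ : ∀ (t : ℕ) (w : Ω), TangentSpace 𝓘(ℝ, E) (x t w))
    (ε : ℕ → ℝ)
    (hmeas : ∀ t, Measurable (x t))
    (hinit : ∀ w, x 0 w = x₀)
    (hstep : ∀ t w, RiemannianSGD.IsExp (x t w)
      (-(α • (RiemannianSGD.grad f (x t w) + δ t w))) (x (t + 1) w))
    (hint : ∀ t, Integrable (fun w => (inner ℝ (δ t w) (δ t w) : ℝ)) P)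
    (hcond : ∀ t, P[fun w => (inner ℝ (δ t w) (δ t w) : ℝ) | RiemannianSGD.pastSigma x t]
      =ᵐ[P] fun _ => ε t)
    (ρ : ℝ) (hρ : ρ = 1 - α * μ / 2) :
    (∀ t, Integrable (fun w => f (x t w)) P ∧
      (∫ w, f (x t w) ∂P) - fstar ≤ ρ ^ t * (f x₀ - fstar)
        + α * ρ ^ t * ∑ ℓ ∈ Finset.range t, ε ℓ * (ρ ^ (ℓ + 1))⁻¹) ∧
    (Filter.Tendsto ε Filter.atTop (𝓝 0) →
      Filter.Tendsto (fun t => (∫ w, f (x t w) ∂P) - fstar) Filter.atTop (𝓝 0)) := by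
  have hL : 0 < L := hμ.trans_le hμL
  have hαμ : α * μ ≤ 1 / 4 := by
    rw [le_div_iff₀ (by positivity)] at hαL
    have := mul_le_mul_of_nonneg_left hμL hα.le
    linarith
  have hρ0 : 0 < ρ := by rw [hρ]; linarith
  have hρ1 : ρ < 1 := by rw [hρ]; linarith [mul_pos hα hμ]
  have hmin : ∀ y, fstar ≤ f y := fun y => hdom.1.2 ⟨y, rfl⟩
  have hstep' : ∀ t w, f (x (t + 1) w) - fstar
      ≤ ρ * (f (x t w) - fstar) + α * inner ℝ (δ t w) (δ t w) := fun t w => by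
    rw [hρ]
    exact hdom.step_le hgeo hf hL hlip hα hαL (hstep t w)
  -- The gap is nonnegative and dominated, through the step inequality, by the previous gap and
  -- `‖δ‖²`.
  have hfi : ∀ t, Integrable (fun w => f (x t w) - fstar) P := by
    intro t
    induction t with
    | zero =>
      simp only [hinit]
      exact integrable_const _
    | succ t ih =>
      refine ((ih.const_mul ρ).add ((hint t).const_mul α)).mono'
        ((hf.continuous.measurable.comp (hmeas (t + 1))).sub_const fstar).aestronglyMeasurable
        (.of_forall fun w => ?_)
      rw [Real.norm_eq_abs, abs_of_nonneg (sub_nonneg.2 (hmin _))]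
      exact hstep' t w
  have hfi' : ∀ t, Integrable (fun w => f (x t w)) P := fun t => by
    exact ((hfi t).add (integrable_const fstar)).congr (.of_forall fun w => sub_add_cancel _ _)
  -- The tower property: the unconditional mean is all the recursion uses.
  have hε : ∀ t, ∫ w, (inner ℝ (δ t w) (δ t w) : ℝ) ∂P = ε t := fun t => by
    rw [← integral_condExp (RiemannianSGD.pastSigma_le hmeas t), integral_congr_ae (hcond t)]
    simp
  set a : ℕ → ℝ := fun t => (∫ w, f (x t w) ∂P) - fstar with ha
  have ha' : ∀ t, a t = ∫ w, (f (x t w) - fstar) ∂P := fun t => by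
    rw [integral_sub (hfi' t) (integrable_const _)]
    simp [ha]
  have hrec : ∀ t, a (t + 1) ≤ ρ * a t + α * ε t := fun t => by
    rw [ha', ha', ← hε t, ← integral_const_mul, ← integral_const_mul,
      ← integral_add ((hfi t).const_mul ρ) ((hint t).const_mul α)]
    exact integral_mono (hfi (t + 1)) (((hfi t).const_mul ρ).add ((hint t).const_mul α))
      (hstep' t)
  have ha0 : a 0 = f x₀ - fstar := by simp [ha, hinit]
  refine ⟨fun t => ⟨hfi' t, ?_⟩, fun hlim => ?_⟩
  · rw [← ha0]
    exact RiemannianSGD.le_pow_mul_add_sum_of_le hρ0 hrec t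
  · refine RiemannianSGD.tendsto_zero_of_le_mul_add hρ0.le hρ1 (fun t => ?_) hrec
      (by simpa using hlim.const_mul α)
    rw [ha']
    exact integral_nonneg fun w => sub_nonneg.2 (hmin _)
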